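/- Let $\Gamma$ be a finite set of queries, $\Sigma$ a (usually finite) set of symbols and $S'$ a set of outputs. A black box is a function $x:\Gamma\to\Sigma$. Let $F$ be a partial function from $S=\Sigma^\Gamma$ to $S'$ with domain $D\subseteq S$; below, $x,y$ range over $D$. Assume that $F$ is not constant on $D$. A \emph{valid weight function} is a map $w:D\times D\to[0,\infty)$ with $w(x,y)=w(y,x)$ and with $w(x,y)=0$ whenever $F(x)=F(y)$. Let $$DL(F)=\min_p\ \max_{x,y:\,F(x)\neq F(y)}\ \frac{1}{\sum_{i:\,x(i)\neq y(i)}p(i)},\qquad PL(F)=\max_w\ \frac{\sum_{x,y}w(x,y)}{\max_i\sum_{x,y:\,x(i)\neq y(i)}w(x,y)},$$ where $p$ ranges over all probability distributions on $\Gamma$ (with $1/0=\infty$), and $w$ over all valid weight functions that are not identically zero (and have finite sum $\sum_{x,y}w(x,y)$, if $\Sigma$ is infinite). Fix a group law $\oplus$ on $\Sigma$. A \emph{nonadaptive quantum algorithm} making $T$ queries is given by unitary operators $U,V$ on the Hilbert space with orthonormal basis $|i_1,\dots,i_T\rangle|\varphi_1,\dots,\varphi_T\rangle|\psi\rangle$,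 with $i_t\in\Gamma$, $\varphi_t\in\Sigma$ and $\psi$ in a set of labels of a work space. On input $x$ it computes, from a fixed basis state $|0\rangle$, the state $V O_x^T U|0\rangle$, where $$O_x^T|i_1,\dots,i_T\rangle|\varphi_1,\dots,\varphi_T\rangle|\psi\rangle=|i_1,\dots,i_T\rangle|\varphi_1\oplus x(i_1),\dots,\varphi_T\oplus x(i_T)\rangle|\psi\rangle,$$ and its output is a function of the outcome of a measurement in the computational basis. Let $Q^{na}_{2,\varepsilon}(F)$ be the smallest $T$ such that some nonadaptive quantum algorithm making $T$ queries outputs $F(x)$ with probability at least $1-\varepsilon$ for every $x\in D$, and let $C_\varepsilon=\bigl(1-2\sqrt{\varepsilon(1-\varepsilon)}\bigr)/2$. \textbf{Theorem.} The minimum and the maxima above are attained, $DL(F)$ is finite, $DL(F)=PL(F)$, and for every $\varepsilon\in[0,\tfrac12]$ $$Q^{na}_{2,\varepsilon}(F)\ \geq\ C_\varepsilon\,DL(F)=C_\varepsilon\,PL(F).$$ -/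

import Mathlib

open scoped ENNReal NNReal

noncomputable section

/-! ### The two optimisation problems

A partial function on the set of black boxes `Γ → Sig` is given by its domain
`dom : Set (Γ → Sig)` and a function `F : dom → R`. -/

/-- `1 / ∑_{i : x i ≠ y i} p i`, equal to `∞` when the sum is zero. -/
def dlPair {Γ Sig : Type*} [Fintype Γ] (p : Γ → ℝ≥0) (x y : Γ → Sig) : ℝ≥0∞ :=
  open scoped Classical in
  (∑ i ∈ Finset.univ.filter (fun i => x i ≠ y i), (p i : ℝ≥0∞))⁻¹

/-- The set of the numbers `1 / ∑_{i : x i ≠ y i} p i` for `x, y` with `F x ≠ F y`. -/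
def dlValues {Γ Sig R : Type*} [Fintype Γ] {dom : Set (Γ → Sig)} (F : dom → R)
    (p : Γ → ℝ≥0) : Set ℝ≥0∞ :=
  {v | ∃ x y : dom, F x ≠ F y ∧ v = dlPair p x.1 y.1}

/-- The maximum, over `x, y` with `F x ≠ F y`, of `1 / ∑_{i : x i ≠ y i} p i`. -/
def dlObjective {Γ Sig R : Type*} [Fintype Γ] {dom : Set (Γ → Sig)} (F : dom → R)
    (p : Γ → ℝ≥0) : ℝ≥0∞ :=
  sSup (dlValues F p)

/-- The probability distributions on the finite set `Γ`. -/
def probDists (Γ : Type*) [Fintype Γ] : Set (Γ → ℝ≥0) :=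
  {p | ∑ i, p i = 1}

/-- `DL(F)`, minimum over probability distributions on `Γ`. -/
def DL {Γ Sig R : Type*} [Fintype Γ] {dom : Set (Γ → Sig)} (F : dom → R) : ℝ≥0∞ :=
  sInf (dlObjective F '' probDists Γ)

/-- Valid weight functions: symmetric, non-negative, and zero on pairs with `F x = F y`. -/
structure IsValidWeight {Γ Sig R : Type*} {dom : Set (Γ → Sig)} (F : dom → R)
    (w : dom → dom → ℝ≥0) : Prop where
  symm : ∀ x y, w x y = w y x
  eq_zero : ∀ x y, F x = F y → w x y = 0

/-- `∑_{x,y} w(x,y)`. -/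
def totalWeight {Γ Sig : Type*} {dom : Set (Γ → Sig)} (w : dom → dom → ℝ≥0) : ℝ≥0∞ :=
  ∑' q : dom × dom, (w q.1 q.2 : ℝ≥0∞)

/-- `∑_{x,y : x i ≠ y i} w(x,y)`. -/
def diffWeight {Γ Sig : Type*} {dom : Set (Γ → Sig)} (w : dom → dom → ℝ≥0) (i : Γ) : ℝ≥0∞ :=
  ∑' q : {q : dom × dom // q.1.1 i ≠ q.2.1 i}, (w q.1.1 q.1.2 : ℝ≥0∞)

/-- `∑_{x,y} w(x,y) / max_i ∑_{x,y : x i ≠ y i} w(x,y)`. -/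
def plObjective {Γ Sig : Type*} {dom : Set (Γ → Sig)} (w : dom → dom → ℝ≥0) : ℝ≥0∞ :=
  totalWeight w / ⨆ i : Γ, diffWeight w i

/-- The valid weight functions for which the quotient in `PL(F)` makes sense: not identically
zero and, which is automatic when `Sig` is finite, with finite sum. -/
def plWeights {Γ Sig R : Type*} {dom : Set (Γ → Sig)} (F : dom → R) :
    Set (dom → dom → ℝ≥0) :=
  {w | IsValidWeight F w ∧ totalWeight w ≠ 0 ∧ totalWeight w ≠ ∞}

/-- `PL(F)`, maximum over valid weight functions. -/
def PL {Γ Sig R : Type*} {dom : Set (Γ → Sig)} (F : dom → R) : ℝ≥0∞ :=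
  sSup (plObjective '' plWeights F)

/-! ### Nonadaptive quantum query algorithms -/

/-- The Hilbert space with orthonormal basis `|a⟩`, `a : ι` (it is `ℂ^ι` when `ι` is finite). -/
abbrev QState (ι : Type*) : Type _ := lp (fun _ : ι => ℂ) 2

/-- The basis vector `|a⟩`. -/
def ket {ι : Type*} (a : ι) : QState ι :=
  open scoped Classical in lp.single 2 a (1 : ℂ)

theorem memℓp_comp_symm {ι : Type*} (e : Equiv.Perm ι) (f : QState ι) :
    Memℓp (fun b => (f : ι → ℂ) (e.symm b)) 2 := by
  have h := lp.memℓp f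
  rw [memℓp_gen_iff (by norm_num)] at h ⊢
  exact (e.symm.summable_iff (f := fun b => ‖(f : ι → ℂ) b‖ ^ (2 : ℝ≥0∞).toReal)).2 h

/-- The unitary operator that maps `|a⟩` to `|e a⟩`, for a permutation `e` of the basis. -/
def permuteBasis {ι : Type*} (e : Equiv.Perm ι) : QState ι ≃ₗᵢ[ℂ] QState ι where
  toFun f := ⟨fun b => (f : ι → ℂ) (e.symm b), memℓp_comp_symm e f⟩
  invFun f := ⟨fun b => (f : ι → ℂ) (e b), memℓp_comp_symm e.symm f⟩
  left_inv f := by ext b; simp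
  right_inv f := by ext b; simp
  map_add' f g := rfl
  map_smul' c f := rfl
  norm_map' f := by
    have h2 : 0 < (2 : ℝ≥0∞).toReal := by norm_num
    rw [lp.norm_eq_tsum_rpow h2, lp.norm_eq_tsum_rpow h2]
    congr 1
    exact e.symm.tsum_eq (fun b => ‖(f : ι → ℂ) b‖ ^ (2 : ℝ≥0∞).toReal)

theorem permuteBasis_apply {ι : Type*} (e : Equiv.Perm ι) (f : QState ι) (b : ι) :
    (permuteBasis e f : ι → ℂ) b = (f : ι → ℂ) (e.symm b) := rfl

theorem permuteBasis_ket {ι : Type*} (e : Equiv.Perm ι) (a : ι) :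
    permuteBasis e (ket a) = ket (e a) := by
  classical
  ext b
  rw [permuteBasis_apply]
  simp only [ket, lp.single_apply, Pi.single_apply, Equiv.symm_apply_eq]

/-- Labels `(i₁, …, i_T), (φ₁, …, φ_T), ψ` of the basis states of an algorithm that makes `T`
queries and has work space `W`. -/
abbrev BasisLabel (Γ Sig W : Type*) (T : ℕ) : Type _ :=
  (Fin T → Γ) × (Fin T → Sig) × W

/-- `(i₁, …, i_T), (φ₁, …, φ_T), ψ ↦ (i₁, …, i_T), (φ₁ + x(i₁), …, φ_T + x(i_T)), ψ`. -/
def oraclePerm {Γ Sig : Type*} [AddGroup Sig] (W : Type*) (T : ℕ) (x : Γ → Sig) :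
    Equiv.Perm (BasisLabel Γ Sig W T) where
  toFun b := (b.1, fun t => b.2.1 t + x (b.1 t), b.2.2)
  invFun b := (b.1, fun t => b.2.1 t - x (b.1 t), b.2.2)
  left_inv b := by simp
  right_inv b := by simp

/-- The unitary operator `O_x^T` that performs `T` simultaneous queries to the black box `x`. -/
def oracle {Γ Sig : Type*} [AddGroup Sig] (W : Type*) (T : ℕ) (x : Γ → Sig) :
    QState (BasisLabel Γ Sig W T) ≃ₗᵢ[ℂ] QState (BasisLabel Γ Sig W T) :=
  permuteBasis (oraclePerm W T x)

/-- A nonadaptive quantum algorithm that makes `T` queries: a work space, a pair `(U, V)` of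
unitary operators, a basis state `|0⟩` as initial state, and the final measurement in the
computational basis, whose outcome `b` is read as the output `output b` (`output` may depend on
some of the registers only). -/
structure NonadaptiveAlgorithm (Γ Sig R : Type*) (T : ℕ) where
  /-- labels of the basis states of the work space -/
  W : Type
  /-- label of the initial state -/
  init : BasisLabel Γ Sig W T
  /-- the unitary operator applied before the queries -/
  U : QState (BasisLabel Γ Sig W T) ≃ₗᵢ[ℂ] QState (BasisLabel Γ Sig W T)
  /-- the unitary operator applied after the queries -/
  V : QState (BasisLabel Γ Sig W T) ≃ₗᵢ[ℂ] QState (BasisLabel Γ Sig W T)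
  /-- the output read off from the outcome of the measurement -/
  output : BasisLabel Γ Sig W T → R

namespace NonadaptiveAlgorithm

variable {Γ Sig R : Type*} [AddGroup Sig] {T : ℕ}

/-- The final state `V O_x^T U |0⟩`. -/
def finalState (A : NonadaptiveAlgorithm Γ Sig R T) (x : Γ → Sig) :
    QState (BasisLabel Γ Sig A.W T) :=
  A.V (oracle A.W T x (A.U (ket A.init)))

/-- The probability that the algorithm outputs `r` on the black box `x`. -/
def outputProb (A : NonadaptiveAlgorithm Γ Sig R T) (x : Γ → Sig) (r : R) : ℝ :=
  ∑' b : {b : BasisLabel Γ Sig A.W T // A.output b = r},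
    ‖(A.finalState x : BasisLabel Γ Sig A.W T → ℂ) b.1‖ ^ 2

/-- The algorithm computes `F` with probability of error at most `ε`. -/
def Computes (A : NonadaptiveAlgorithm Γ Sig R T) {dom : Set (Γ → Sig)} (F : dom → R)
    (ε : ℝ) : Prop :=
  ∀ x : dom, 1 - A.outputProb x.1 (F x) ≤ ε

end NonadaptiveAlgorithm

/-- The nonadaptive quantum query complexity of `F`: the smallest number of queries of a
nonadaptive quantum algorithm computing `F` with probability of error at most `ε`. -/
def naQueryComplexity {Γ Sig R : Type*} [AddGroup Sig] {dom : Set (Γ → Sig)} (F : dom → R)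
    (ε : ℝ) : ℕ∞ :=
  ⨅ (T : ℕ) (_ : ∃ A : NonadaptiveAlgorithm Γ Sig R T, A.Computes F ε), (T : ℕ∞)

/-- The constant `C_ε = (1 - 2 √(ε (1 - ε))) / 2`. -/
def errorConst (ε : ℝ) : ℝ := (1 - 2 * Real.sqrt (ε * (1 - ε))) / 2

end

/-! A pair with `F x ≠ F y` matters only through the set of queries where `x` and `y` differ, and
`Γ` has finitely many subsets. Hence `DL` and `PL` are the two sides of a finite matrix game, query
against difference set, with payoff 1 when the query lies in the set. With `v > 0` the value of the
game, both equal `1 / v`; double counting gives `PL ≤ DL`, and optimal strategies give the converse.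
For the lower bound, the final states on `x` and `y` can differ only through the basis states that
query a distinguishing position. Distinguishing the outputs needs squared distance at least `4 *
errorConst ε`, so these basis states have mass at least `errorConst ε`. For `p` the average of the
`T` query marginals, that mass is at most `T` times the `p`-mass of the difference set. -/

/-- Von Neumann's minimax theorem for matrix games. -/
theorem Matrix.exists_optimal_strategies {ι κ : Type*} [Fintype ι] [Fintype κ]
    [Nonempty ι] [Nonempty κ] (M : Matrix ι κ ℝ) :
    ∃ p ∈ stdSimplex ℝ ι, ∃ q ∈ stdSimplex ℝ κ, ∃ v : ℝ,
      (∀ j, v ≤ ∑ i, p i * M i j) ∧ ∀ i, ∑ j, M i j * q j ≤ v := by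
  classical
  let B : (ι → ℝ) →ₗ[ℝ] (κ → ℝ) →ₗ[ℝ] ℝ := Matrix.toLinearMap₂' ℝ M
  obtain ⟨q, hq, p, hp, h⟩ := Sion.exists_isSaddlePointOn (X := stdSimplex ℝ κ)
    (Y := stdSimplex ℝ ι) (f := fun q p => B p q)
    ⟨_, single_mem_stdSimplex ℝ (Classical.arbitrary κ)⟩ (convex_stdSimplex ℝ κ)
    (isCompact_stdSimplex ℝ κ)
    (fun p _ => (B p).continuous_of_finiteDimensional.lowerSemicontinuous.lowerSemicontinuousOn _)
    (fun p _ => ((B p).convexOn (convex_stdSimplex ℝ κ)).quasiconvexOn)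
    (convex_stdSimplex ℝ ι) ⟨_, single_mem_stdSimplex ℝ (Classical.arbitrary ι)⟩
    (isCompact_stdSimplex ℝ ι)
    (fun q _ =>
      (B.flip q).continuous_of_finiteDimensional.upperSemicontinuous.upperSemicontinuousOn _)
    (fun q _ => ((B.flip q).concaveOn (convex_stdSimplex ℝ ι)).quasiconcaveOn)
  refine ⟨p, hp, q, hq, B p q, fun j => ?_, fun i => ?_⟩
  · refine (h _ (single_mem_stdSimplex ℝ j) _ hp).trans_eq ?_
    simp [B, Matrix.toLinearMap₂'_apply', dotProduct]
  · refine Eq.trans_le ?_ (h _ hq _ (single_mem_stdSimplex ℝ i))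
    simp [B, Matrix.toLinearMap₂'_apply', Matrix.mulVec, dotProduct, Pi.single_apply]

/-! ### Duality of `DL` and `PL` -/

section Duality

variable {Γ Sig R : Type*} [Fintype Γ] {dom : Set (Γ → Sig)} {F : dom → R}

/-- The set of the queries that distinguish two black boxes. -/
noncomputable def diffSet (x y : Γ → Sig) : Finset Γ :=
  open scoped Classical in Finset.univ.filter (fun i => x i ≠ y i)

theorem mem_diffSet {x y : Γ → Sig} {i : Γ} : i ∈ diffSet x y ↔ x i ≠ y i := by
  simp [diffSet]

theorem diffSet_comm (x y : Γ → Sig) : diffSet x y = diffSet y x := by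
  ext i
  simp [mem_diffSet, ne_comm]

theorem dlPair_eq (p : Γ → ℝ≥0) (x y : Γ → Sig) :
    dlPair p x y = (∑ i ∈ diffSet x y, (p i : ℝ≥0∞))⁻¹ := rfl

/-- The value depends only on the difference set, so the maximum is attained even for infinite
`Sig`. -/
theorem finite_dlValues (F : dom → R) (p : Γ → ℝ≥0) : (dlValues F p).Finite := by
  refine (Set.finite_range fun A : Finset Γ => (∑ i ∈ A, (p i : ℝ≥0∞))⁻¹).subset ?_
  rintro _ ⟨x, y, -, rfl⟩
  exact ⟨diffSet x.1 y.1, rfl⟩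

theorem isGreatest_dlObjective (hF : ∃ x y : dom, F x ≠ F y) (p : Γ → ℝ≥0) :
    IsGreatest (dlValues F p) (dlObjective F p) := by
  obtain ⟨x, y, hxy⟩ := hF
  have hne : (dlValues F p).Nonempty := ⟨_, x, y, hxy, rfl⟩
  exact ⟨hne.csSup_mem (finite_dlValues F p), fun _ h => le_sSup h⟩

open scoped Classical in
theorem diffWeight_eq (w : dom → dom → ℝ≥0) (i : Γ) :
    diffWeight w i =
      ∑' q : dom × dom, if i ∈ diffSet q.1.1 q.2.1 then (w q.1 q.2 : ℝ≥0∞) else 0 := by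
  classical
  refine (tsum_subtype {q : dom × dom | q.1.1 i ≠ q.2.1 i}
    fun q => (w q.1 q.2 : ℝ≥0∞)).trans ?_
  simp [Set.indicator_apply, mem_diffSet]

/-- Weak duality by double counting: charge each pair to its distinguishing queries, weighted by
`p`, then exchange the sums. Finiteness of the objective keeps the `p`-mass of every relevant
difference set positive. -/
theorem totalWeight_le {p : Γ → ℝ≥0} (hp : p ∈ probDists Γ) {w : dom → dom → ℝ≥0}
    (hw : IsValidWeight F w) (hm : dlObjective F p ≠ ∞) :
    totalWeight w ≤ dlObjective F p * ⨆ i, diffWeight w i := by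
  classical
  set m := dlObjective F p
  have hp1 : ∑ i, (p i : ℝ≥0∞) = 1 := by
    rw [← ENNReal.ofNNReal_finsetSum, show ∑ i, p i = 1 from hp, ENNReal.coe_one]
  have key : ∀ q : dom × dom, (w q.1 q.2 : ℝ≥0∞) ≤
      m * ∑ i, p i * if i ∈ diffSet q.1.1 q.2.1 then (w q.1 q.2 : ℝ≥0∞) else 0 := by
    rintro ⟨x, y⟩
    by_cases hxy : F x = F y
    · simp [hw.eq_zero x y hxy]
    have h1 : (∑ i ∈ diffSet x.1 y.1, (p i : ℝ≥0∞))⁻¹ ≤ m := le_sSup ⟨x, y, hxy, rfl⟩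
    have hle : ∑ i ∈ diffSet x.1 y.1, (p i : ℝ≥0∞) ≤ 1 :=
      hp1 ▸ Finset.sum_le_sum_of_subset (Finset.subset_univ _)
    have h2 : ∑ i ∈ diffSet x.1 y.1, (p i : ℝ≥0∞) ≠ 0 := fun h0 => hm <| by
      simpa [h0] using h1
    have h3 : 1 ≤ m * ∑ i ∈ diffSet x.1 y.1, (p i : ℝ≥0∞) := by
      rw [← ENNReal.inv_mul_cancel h2 (hle.trans_lt ENNReal.one_lt_top).ne]
      gcongr
    calc (w x y : ℝ≥0∞) = 1 * w x y := (one_mul _).symm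
      _ ≤ m * (∑ i ∈ diffSet x.1 y.1, (p i : ℝ≥0∞)) * w x y := by gcongr
      _ = _ := by
        simp [mul_assoc, Finset.sum_mul]
  calc totalWeight w ≤ ∑' q : dom × dom,
        m * ∑ i, p i * if i ∈ diffSet q.1.1 q.2.1 then (w q.1 q.2 : ℝ≥0∞) else 0 :=
      ENNReal.tsum_le_tsum key
    _ = m * ∑ i, p i * diffWeight w i := by
      rw [ENNReal.tsum_mul_left, Summable.tsum_finsetSum fun _ _ => ENNReal.summable]
      simp_rw [ENNReal.tsum_mul_left, diffWeight_eq]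
    _ ≤ m * ∑ i, p i * ⨆ i, diffWeight w i := by
      gcongr with i
      exact le_iSup (diffWeight w) i
    _ = m * ⨆ i, diffWeight w i := by rw [← Finset.sum_mul, hp1, one_mul]

theorem plObjective_le_dlObjective {p : Γ → ℝ≥0} (hp : p ∈ probDists Γ)
    {w : dom → dom → ℝ≥0} (hw : w ∈ plWeights F) : plObjective w ≤ dlObjective F p := by
  by_cases hm : dlObjective F p = ∞
  · simp [hm]
  · exact ENNReal.div_le_of_le_mul (totalWeight_le hp hw.1 hm)

/-- The symmetric weight function that puts weight `2 * q j` on the unordered pair `s j`. -/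
noncomputable def pairWeight {κ : Type*} [Fintype κ] (s : κ → dom × dom) (q : κ → ℝ≥0)
    (x y : dom) : ℝ≥0 :=
  open scoped Classical in
  ∑ j, ((if (x, y) = s j then q j else 0) + if (x, y) = (s j).swap then q j else 0)

theorem pairWeight_comm {κ : Type*} [Fintype κ] (s : κ → dom × dom) (q : κ → ℝ≥0) (x y : dom) :
    pairWeight s q x y = pairWeight s q y x := by
  classical
  refine Finset.sum_congr rfl fun j _ => ?_
  rw [add_comm]
  congr 2 <;> simp [Prod.ext_iff, and_comm]

/-- Taking `c` constant gives the total weight; taking `c` the indicator of the pairs distinguished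
by `i` gives `diffWeight`. -/
theorem tsum_mul_pairWeight {κ : Type*} [Fintype κ] (s : κ → dom × dom) (q : κ → ℝ≥0)
    (c : dom × dom → ℝ≥0∞) :
    ∑' r : dom × dom, c r * (pairWeight s q r.1 r.2 : ℝ≥0∞) =
      ∑ j, (c (s j) + c (s j).swap) * q j := by
  classical
  simp only [pairWeight, Prod.mk.eta, ENNReal.ofNNReal_finsetSum, ENNReal.coe_add, Finset.mul_sum]
  rw [Summable.tsum_finsetSum fun _ _ => ENNReal.summable]
  refine Finset.sum_congr rfl fun j _ => ?_
  simp_rw [mul_add]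
  rw [ENNReal.tsum_add, tsum_eq_single (s j), tsum_eq_single (s j).swap, add_mul]
  · simp
  · intro b hb
    simp [hb]
  · intro b hb
    simp [hb]

theorem isValidWeight_pairWeight {κ : Type*} [Fintype κ] {s : κ → dom × dom}
    (hs : ∀ j, F (s j).1 ≠ F (s j).2) (q : κ → ℝ≥0) : IsValidWeight F (pairWeight s q) where
  symm := pairWeight_comm s q
  eq_zero x y hxy := by
    classical
    refine Finset.sum_eq_zero fun j _ => ?_
    rw [if_neg, if_neg, add_zero]
    · intro h
      rw [Prod.ext_iff] at h
      exact hs j (by rw [← show x = (s j).2 from h.1, ← show y = (s j).1 from h.2, hxy])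
    · intro h
      exact hs j (by rw [← h]; exact hxy)

theorem exists_dlObjective_le_plObjective (hF : ∃ x y : dom, F x ≠ F y) :
    ∃ p ∈ probDists Γ, ∃ w ∈ plWeights F,
      dlObjective F p ≤ plObjective w ∧ dlObjective F p ≠ ∞ := by
  classical
  -- Columns are difference sets rather than pairs, which keeps the game finite; `s` picks one pair
  -- for each set.
  let κ := {A : Finset Γ // ∃ r : dom × dom, F r.1 ≠ F r.2 ∧ diffSet r.1.1 r.2.1 = A}
  choose s hs hsA using fun j : κ => j.2
  obtain ⟨x₀, y₀, h₀⟩ := hF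
  have hmem : ∀ A : κ, A.1.Nonempty := by
    rintro ⟨A, ⟨x, y⟩, hxy, rfl⟩
    by_contra hA
    rw [Finset.not_nonempty_iff_eq_empty] at hA
    refine hxy (congrArg F (Subtype.ext (funext fun i => ?_)))
    by_contra hi
    exact Finset.notMem_empty i (hA ▸ mem_diffSet.2 hi)
  have hκ : Nonempty κ := ⟨⟨_, (x₀, y₀), h₀, rfl⟩⟩
  have hΓ : Nonempty Γ := (hmem hκ.some).to_type
  obtain ⟨p, hp, q, hq, v, hpv, hqv⟩ :=
    Matrix.exists_optimal_strategies (fun (i : Γ) (A : κ) => if i ∈ A.1 then (1 : ℝ) else 0)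
  -- Some column `A` has positive weight and is nonempty; the row of any query in `A` pays at least
  -- `q A`.
  have hv : 0 < v := by
    obtain ⟨A, -, hA⟩ : ∃ A ∈ Finset.univ, 0 < q A := by
      apply Finset.exists_lt_of_sum_lt
      simp [hq.2]
    obtain ⟨i, hi⟩ := hmem A
    refine hA.trans_le (le_trans ?_ (hqv i))
    refine le_trans ?_ (Finset.single_le_sum (fun B _ => ?_) (Finset.mem_univ A))
    · simp [hi]
    · exact mul_nonneg (by split_ifs <;> norm_num) (hq.1 B)
  have hp1 : ∑ i, (p i).toNNReal = 1 := by
    rw [← Real.toNNReal_sum_of_nonneg fun i _ => hp.1 i, hp.2, Real.toNNReal_one]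
  have hq1 : ∑ A, (ENNReal.ofReal (q A)) = 1 := by
    rw [← ENNReal.ofReal_sum_of_nonneg fun i _ => hq.1 i, hq.2, ENNReal.ofReal_one]
  have hdl : dlObjective F (fun i => (p i).toNNReal) ≤ (ENNReal.ofReal v)⁻¹ := by
    refine sSup_le ?_
    rintro _ ⟨x, y, hxy, rfl⟩
    rw [dlPair_eq, ENNReal.inv_le_inv]
    change _ ≤ ∑ i ∈ _, ENNReal.ofReal (p i)
    rw [← ENNReal.ofReal_sum_of_nonneg fun i _ => hp.1 i]
    refine ENNReal.ofReal_le_ofReal ((hpv ⟨_, (x, y), hxy, rfl⟩).trans_eq ?_)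
    simp
  -- Each pair is counted in both orders, hence the 2, which cancels against the 2 in `hdiff`.
  have htot : totalWeight (pairWeight s fun A => (q A).toNNReal) = 2 := by
    have := tsum_mul_pairWeight s (fun A => (q A).toNNReal) 1
    simp only [Pi.one_apply, one_mul] at this
    rw [totalWeight, this, ← Finset.mul_sum]
    change _ * ∑ A, (ENNReal.ofReal (q A)) = _
    rw [hq1, mul_one, one_add_one_eq_two]
  have hdiff : ∀ i, diffWeight (pairWeight s fun A => (q A).toNNReal) i ≤
      2 * ENNReal.ofReal v := by
    intro i
    have := tsum_mul_pairWeight s (fun A => (q A).toNNReal)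
      fun r => if i ∈ diffSet r.1.1 r.2.1 then 1 else 0
    simp only [ite_mul, one_mul, zero_mul] at this
    rw [diffWeight_eq, this]
    calc _ = ∑ A : κ, 2 * ENNReal.ofReal ((if i ∈ A.1 then 1 else 0) * q A) := by
          refine Finset.sum_congr rfl fun A _ => ?_
          simp only [Prod.fst_swap, Prod.snd_swap, diffSet_comm (s A).2.1, hsA]
          split_ifs
          · rw [one_add_one_eq_two, one_mul]; rfl
          · simp
      _ ≤ _ := by
          rw [← Finset.mul_sum, ← ENNReal.ofReal_sum_of_nonneg]
          · gcongr
            exact hqv i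
          · exact fun A _ => mul_nonneg (by split_ifs <;> norm_num) (hq.1 A)
  refine ⟨_, hp1, pairWeight s fun A => (q A).toNNReal, ⟨isValidWeight_pairWeight hs _, by simp [htot], by simp [htot]⟩,
    hdl.trans ?_, ne_top_of_le_ne_top (by simpa using hv) hdl⟩
  rw [plObjective, htot, ENNReal.le_div_iff_mul_le]
  · calc _ ≤ (ENNReal.ofReal v)⁻¹ * (2 * ENNReal.ofReal v) := by
          gcongr
          exact iSup_le hdiff
      _ = 2 := by
          rw [mul_left_comm, ENNReal.inv_mul_cancel (by simpa using hv) ENNReal.ofReal_ne_top,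
            mul_one]
  · right; norm_num
  · right; norm_num

end Duality

/-! ### Distances between quantum states -/

section QState

variable {ι : Type*}

theorem hasSum_sq_norm (f : QState ι) : HasSum (fun b => ‖f b‖ ^ 2) (‖f‖ ^ 2) := by
  simpa using lp.hasSum_norm (p := 2) (by norm_num) f

theorem norm_ket (a : ι) : ‖ket a‖ = 1 := by
  simp [ket, lp.norm_single]

theorem abs_sq_norm_sub_sq_norm_le {E : Type*} [NormedAddCommGroup E] [InnerProductSpace ℝ E]
    (a b : E) : |‖a‖ ^ 2 - ‖b‖ ^ 2| ≤ ‖a - b‖ * ‖a + b‖ := by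
  refine Eq.trans_le ?_ (abs_real_inner_le_norm (a - b) (a + b))
  rw [inner_sub_left, inner_add_right, inner_add_right, real_inner_self_eq_norm_sq,
    real_inner_self_eq_norm_sq, real_inner_comm]
  congr 1
  ring

/-- Two states that are told apart by a measurement are far apart. -/
theorem le_norm_sub_mul_norm_add {u v : QState ι} (hu : ‖u‖ = 1) (hv : ‖v‖ = 1) {s t : Set ι}
    (hst : Disjoint s t) {ε : ℝ} (hs : 1 - ε ≤ ∑' b, s.indicator (fun b => ‖u b‖ ^ 2) b)
    (ht : 1 - ε ≤ ∑' b, t.indicator (fun b => ‖v b‖ ^ 2) b) :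
    2 - 4 * ε ≤ ‖u - v‖ * ‖u + v‖ := by
  have su := hasSum_sq_norm u
  have sv := hasSum_sq_norm v
  have hsu := (su.summable.indicator s).hasSum
  have hsv := (sv.summable.indicator s).hasSum
  have htv := (sv.summable.indicator t).hasSum
  -- Hence `v` gives `s` mass at most `ε`, while `u` gives it at least `1 - ε`.
  have h1 : ∑' b, s.indicator (fun b => ‖v b‖ ^ 2) b
      + ∑' b, t.indicator (fun b => ‖v b‖ ^ 2) b ≤ 1 := by
    have h := hasSum_le (fun b => ?_) (hsv.add htv) sv
    · simpa [hv] using h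
    · have h' := congrFun (Set.indicator_union_of_disjoint hst fun b => ‖v b‖ ^ 2) b
      exact h'.symm.trans_le (Set.indicator_le_self' (fun _ _ => by positivity) b)
  obtain ⟨hsum, hle⟩ := lp.tsum_mul_le_mul_norm (p := 2) (q := 2)
    (by simpa using Real.HolderConjugate.two_two) (u - v) (u + v)
  -- With `d = ‖u b‖ ^ 2 - ‖v b‖ ^ 2`, the left term is `d` on `s` and `-d` off `s`, so at most
  -- `|d|`. The `su.sub sv` part sums to 0, and Cauchy–Schwarz bounds the right side.
  have h2 := hasSum_le (fun b => ?_) (((hsu.sub hsv).mul_left 2).sub (su.sub sv)) hsum.hasSum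
  · rw [hu, hv] at h2
    linarith
  · have h := abs_le.1 (abs_sq_norm_sub_sq_norm_le (u b) (v b))
    simp only [lp.coeFn_sub, lp.coeFn_add, Pi.sub_apply, Pi.add_apply]
    by_cases hb : b ∈ s <;> simp only [hb, Set.indicator_of_mem, Set.indicator_of_notMem,
      not_false_eq_true] <;> linarith

/-- With `d = ‖u - v‖ ^ 2`, the parallelogram law turns the hypothesis into `(2 - 4ε)² ≤ d(4 - d)`,
that is `(d - 2)² ≤ 16ε(1 - ε)`. -/
theorem errorConst_le_sq_norm_sub {u v : QState ι} (hu : ‖u‖ = 1) (hv : ‖v‖ = 1) {ε : ℝ}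
    (hε₀ : 0 ≤ ε) (hε : ε ≤ 1 / 2) (h : 2 - 4 * ε ≤ ‖u - v‖ * ‖u + v‖) :
    4 * errorConst ε ≤ ‖u - v‖ ^ 2 := by
  have hpar := parallelogram_law_with_norm ℂ u v
  have hsqrt : Real.sqrt (ε * (1 - ε)) ^ 2 = ε * (1 - ε) :=
    Real.sq_sqrt (mul_nonneg hε₀ (by linarith))
  have h1 : (2 - 4 * ε) ^ 2 ≤ ‖u - v‖ ^ 2 * ‖u + v‖ ^ 2 := by
    rw [← mul_pow]
    exact pow_le_pow_left₀ (by linarith) h 2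
  have h2 : (‖u - v‖ ^ 2 - 2) ^ 2 ≤ (4 * Real.sqrt (ε * (1 - ε))) ^ 2 := by
    rw [mul_pow, hsqrt]
    have h3 : ‖u + v‖ ^ 2 = 4 - ‖u - v‖ ^ 2 := by
      rw [hu, hv] at hpar
      linarith
    rw [h3] at h1
    linarith
  have h4 := (abs_le.1 (abs_le_of_sq_le_sq h2 (by positivity))).1
  rw [errorConst]
  linarith

theorem sq_norm_sub_le {E : Type*} [SeminormedAddCommGroup E] (a b : E) :
    ‖a - b‖ ^ 2 ≤ 2 * ‖a‖ ^ 2 + 2 * ‖b‖ ^ 2 := by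
  have h := pow_le_pow_left₀ (norm_nonneg _) (norm_sub_le a b) 2
  linarith [sq_nonneg (‖a‖ - ‖b‖)]

/-- Off `s` the two images cancel; on `s`, which both permutations preserve, each image carries the
same mass as `f`. -/
theorem sq_norm_permuteBasis_sub_le (e₁ e₂ : Equiv.Perm ι) (f : QState ι) {s : Set ι}
    (h₁ : ∀ b, e₁.symm b ∈ s ↔ b ∈ s) (h₂ : ∀ b, e₂.symm b ∈ s ↔ b ∈ s)
    (h : ∀ b ∉ s, e₁.symm b = e₂.symm b) :
    ‖permuteBasis e₁ f - permuteBasis e₂ f‖ ^ 2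
      ≤ 4 * ∑' b, s.indicator (fun b => ‖f b‖ ^ 2) b := by
  have hsum := ((hasSum_sq_norm f).summable.indicator s).hasSum
  have hs₁ := (Equiv.hasSum_iff e₁.symm).2 hsum
  have hs₂ := (Equiv.hasSum_iff e₂.symm).2 hsum
  have key := hasSum_le (fun b => ?_) (hasSum_sq_norm (permuteBasis e₁ f - permuteBasis e₂ f))
    ((hs₁.mul_left 2).add (hs₂.mul_left 2))
  · linarith
  have hval : (permuteBasis e₁ f - permuteBasis e₂ f) b = f (e₁.symm b) - f (e₂.symm b) := rfl
  simp only [hval, Function.comp_apply]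
  by_cases hb : b ∈ s
  · rw [Set.indicator_of_mem ((h₁ b).2 hb), Set.indicator_of_mem ((h₂ b).2 hb)]
    exact sq_norm_sub_le _ _
  · rw [h b hb, sub_self, norm_zero, Set.indicator_of_notMem (mt (h₂ b).1 hb)]
    norm_num

end QState

/-! ### The query lower bound -/

/-- Averaging the marginals of a distribution gives a union bound. -/
theorem exists_probDist_union_bound {Γ ι : Type*} [Fintype Γ] {T : ℕ} (hT : T ≠ 0)
    (g : ι → Fin T → Γ) {μ : ι → ℝ≥0∞} (hμ : ∑' b, μ b = 1) :
    ∃ p ∈ probDists Γ, ∀ A : Finset Γ,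
      ∑' b, {b | ∃ t, g b t ∈ A}.indicator μ b ≤ T * ∑ i ∈ A, (p i : ℝ≥0∞) := by
  classical
  have hT₀ : (T : ℝ≥0∞) ≠ 0 := by exact_mod_cast hT
  let P : Γ → ℝ≥0∞ := fun i => (∑ t, ∑' b, if g b t = i then μ b else 0) / T
  have hP : ∀ A : Finset Γ, T * ∑ i ∈ A, P i = ∑ t, ∑' b, if g b t ∈ A then μ b else 0 := by
    intro A
    simp only [P, div_eq_mul_inv]
    rw [← Finset.sum_mul, mul_comm, mul_assoc,
      ENNReal.inv_mul_cancel hT₀ (ENNReal.natCast_ne_top T), mul_one, Finset.sum_comm]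
    refine Finset.sum_congr rfl fun t _ => ?_
    rw [← Summable.tsum_finsetSum fun _ _ => ENNReal.summable]
    simp
  have hP1 : ∑ i, P i = 1 := by
    have h := hP Finset.univ
    simp only [Finset.mem_univ, if_true, hμ, Finset.sum_const, Finset.card_univ, Fintype.card_fin,
      nsmul_eq_mul, mul_one] at h
    exact (ENNReal.mul_right_inj hT₀ (ENNReal.natCast_ne_top T)).1 (by rw [h, mul_one])
  have hfin : ∀ i, P i ≠ ∞ := fun i =>
    ne_top_of_le_ne_top ENNReal.one_ne_top
      (hP1 ▸ Finset.single_le_sum (fun _ _ => zero_le) (Finset.mem_univ i))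
  have hcoe : ∀ i, ((P i).toNNReal : ℝ≥0∞) = P i := fun i => ENNReal.coe_toNNReal (hfin i)
  refine ⟨fun i => (P i).toNNReal, ?_, fun A => ?_⟩
  · change ∑ i, (P i).toNNReal = 1
    rw [← ENNReal.coe_inj, ENNReal.ofNNReal_finsetSum]
    simp [hcoe, hP1]
  · simp only [hcoe]
    rw [hP, ← Summable.tsum_finsetSum fun _ _ => ENNReal.summable]
    refine ENNReal.tsum_le_tsum fun b => ?_
    by_cases hb : ∃ t, g b t ∈ A
    · rw [Set.indicator_of_mem (show b ∈ {b | ∃ t, g b t ∈ A} from hb)]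
      obtain ⟨t, ht⟩ := hb
      refine le_trans ?_ (Finset.single_le_sum (fun _ _ => zero_le) (Finset.mem_univ t))
      rw [if_pos ht]
    · rw [Set.indicator_of_notMem (show b ∉ {b | ∃ t, g b t ∈ A} from hb)]
      exact zero_le

namespace NonadaptiveAlgorithm

variable {Γ Sig R : Type*} [AddGroup Sig] {T : ℕ}

theorem norm_finalState (A : NonadaptiveAlgorithm Γ Sig R T) (x : Γ → Sig) :
    ‖A.finalState x‖ = 1 := by
  rw [finalState, oracle, LinearIsometryEquiv.norm_map, LinearIsometryEquiv.norm_map,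
    LinearIsometryEquiv.norm_map, norm_ket]

theorem outputProb_eq (A : NonadaptiveAlgorithm Γ Sig R T) (x : Γ → Sig) (r : R) :
    A.outputProb x r =
      ∑' b, {b | A.output b = r}.indicator (fun b => ‖A.finalState x b‖ ^ 2) b :=
  tsum_subtype {b | A.output b = r} fun b => ‖A.finalState x b‖ ^ 2

theorem sq_norm_finalState_sub_le [Fintype Γ] (A : NonadaptiveAlgorithm Γ Sig R T)
    (x y : Γ → Sig) :
    ‖A.finalState x - A.finalState y‖ ^ 2 ≤
      4 * ∑' b, {b : BasisLabel Γ Sig A.W T | ∃ t, b.1 t ∈ diffSet x y}.indicator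
        (fun b => ‖A.U (ket A.init) b‖ ^ 2) b := by
  rw [finalState, finalState, ← map_sub, LinearIsometryEquiv.norm_map]
  -- The oracle leaves the index registers unchanged, so the set is invariant by definition.
  refine sq_norm_permuteBasis_sub_le _ _ _ (fun b => Iff.rfl) (fun b => Iff.rfl) fun b hb => ?_
  have h : ∀ t, x (b.1 t) = y (b.1 t) := fun t => by
    by_contra ht
    exact hb ⟨t, mem_diffSet.2 ht⟩
  change (b.1, fun t => b.2.1 t - x (b.1 t), b.2.2) = (b.1, fun t => b.2.1 t - y (b.1 t), b.2.2)
  simp only [h]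

/-- An algorithm that computes `F` queries, with substantial probability, a position that
distinguishes `x` from `y`, whenever `F x ≠ F y`. -/
theorem Computes.errorConst_le [Fintype Γ] {A : NonadaptiveAlgorithm Γ Sig R T}
    {dom : Set (Γ → Sig)} {F : dom → R} {ε : ℝ} (hA : A.Computes F ε) (hε₀ : 0 ≤ ε)
    (hε : ε ≤ 1 / 2) {x y : dom} (hxy : F x ≠ F y) :
    errorConst ε ≤ ∑' b, {b : BasisLabel Γ Sig A.W T | ∃ t, b.1 t ∈ diffSet x.1 y.1}.indicator
      (fun b => ‖A.U (ket A.init) b‖ ^ 2) b := by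
  have hdisj : Disjoint {b | A.output b = F x} {b | A.output b = F y} :=
    Set.disjoint_left.2 fun b hx hy => hxy (hx.symm.trans hy)
  have h := le_norm_sub_mul_norm_add (A.norm_finalState x) (A.norm_finalState y) hdisj (ε := ε)
    (by rw [← outputProb_eq]; linarith [hA x]) (by rw [← outputProb_eq]; linarith [hA y])
  have h1 := errorConst_le_sq_norm_sub (A.norm_finalState x) (A.norm_finalState y) hε₀ hε h
  linarith [h1.trans (A.sq_norm_finalState_sub_le x y)]

theorem Computes.errorConst_mul_DL_le [Fintype Γ] {A : NonadaptiveAlgorithm Γ Sig R T}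
    {dom : Set (Γ → Sig)} {F : dom → R} {ε : ℝ} (hA : A.Computes F ε)
    (hF : ∃ x y : dom, F x ≠ F y) (hε₀ : 0 ≤ ε) (hε : ε ≤ 1 / 2) :
    ENNReal.ofReal (errorConst ε) * DL F ≤ T := by
  -- Without queries there are no marginals to average, but the set of distinguishing basis states
  -- is empty, so `errorConst ε ≤ 0`.
  rcases Nat.eq_zero_or_pos T with rfl | hT
  · obtain ⟨x, y, hxy⟩ := hF
    have h := hA.errorConst_le hε₀ hε hxy
    simp only [IsEmpty.exists_iff, Set.ofPred_false, Set.indicator_empty, tsum_zero] at h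
    simp [ENNReal.ofReal_eq_zero.2 h]
  set ψ := A.U (ket A.init)
  have hψ : HasSum (fun b => ‖ψ b‖ ^ 2) 1 := by
    simpa [ψ, norm_ket] using hasSum_sq_norm ψ
  have hμ : ∑' b, ENNReal.ofReal (‖ψ b‖ ^ 2) = 1 := by
    rw [← ENNReal.ofReal_tsum_of_nonneg (fun b => by positivity) hψ.summable, hψ.tsum_eq,
      ENNReal.ofReal_one]
  obtain ⟨p, hp, hpA⟩ := exists_probDist_union_bound hT.ne' (fun b => b.1) hμ
  have hDL : DL F ≤ dlObjective F p := sInf_le (Set.mem_image_of_mem _ hp)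
  refine le_trans (mul_le_mul_right hDL _) ?_
  -- The maximum is attained, so it suffices to treat the worst pair for this `p`.
  obtain ⟨x, y, hxy, hval⟩ := (isGreatest_dlObjective hF p).1
  rw [hval, dlPair_eq, ← div_eq_mul_inv]
  refine ENNReal.div_le_of_le_mul (le_trans ?_ (hpA (diffSet x.1 y.1)))
  refine (ENNReal.ofReal_le_ofReal (hA.errorConst_le hε₀ hε hxy)).trans_eq ?_
  rw [ENNReal.ofReal_tsum_of_nonneg (fun b => Set.indicator_nonneg (fun _ _ => by positivity) b)
    (hψ.summable.indicator _)]
  refine tsum_congr fun b => ?_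
  by_cases hb : b ∈ {b : BasisLabel Γ Sig A.W T | ∃ t, b.1 t ∈ diffSet x.1 y.1}
  · rw [Set.indicator_of_mem hb, Set.indicator_of_mem hb]
  · rw [Set.indicator_of_notMem hb, Set.indicator_of_notMem hb, ENNReal.ofReal_zero]

end NonadaptiveAlgorithm

theorem le_naQueryComplexity {Γ Sig R : Type*} [AddGroup Sig] {dom : Set (Γ → Sig)} {F : dom → R}
    {ε : ℝ} {c : ℝ≥0∞}
    (h : ∀ (T : ℕ) (A : NonadaptiveAlgorithm Γ Sig R T), A.Computes F ε → c ≤ T) :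
    c ≤ (naQueryComplexity F ε : ℝ≥0∞) := by
  by_cases hne : ∃ (T : ℕ) (A : NonadaptiveAlgorithm Γ Sig R T), A.Computes F ε
  · classical
    obtain ⟨A, hA⟩ := Nat.find_spec hne
    have heq : ((Nat.find hne : ℕ) : ℕ∞) ≤ naQueryComplexity F ε :=
      le_iInf₂ fun T hT => by exact_mod_cast Nat.find_min' hne hT
    exact (h _ A hA).trans (by exact_mod_cast ENat.toENNReal_le.2 heq)
  -- If no algorithm computes `F`, the infimum is over the empty set.
  · have : naQueryComplexity F ε = ⊤ := by
      simp only [naQueryComplexity, iInf_eq_top]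
      exact fun T hT => (hne ⟨T, hT⟩).elim
    simp [this]

theorem mainTheorem3 {Γ Sig R : Type*} [Fintype Γ] [AddGroup Sig]
    (dom : Set (Γ → Sig)) (F : dom → R) (hF : ∃ x y : dom, F x ≠ F y)
    (ε : ℝ) (hε₀ : 0 ≤ ε) (hε : ε ≤ 1 / 2) :
    (∀ p ∈ probDists Γ, IsGreatest (dlValues F p) (dlObjective F p)) ∧
    IsLeast (dlObjective F '' probDists Γ) (DL F) ∧
    IsGreatest (plObjective '' plWeights F) (PL F) ∧
    DL F = PL F ∧
    DL F ≠ ∞ ∧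
    ENNReal.ofReal (errorConst ε) * DL F ≤ (naQueryComplexity F ε : ℝ≥0∞) ∧
    ENNReal.ofReal (errorConst ε) * PL F ≤ (naQueryComplexity F ε : ℝ≥0∞) := by
  obtain ⟨p, hp, w, hw, hpw, hfin⟩ := exists_dlObjective_le_plObjective hF
  have heq : plObjective w = dlObjective F p := (plObjective_le_dlObjective hp hw).antisymm hpw
  have hleast : IsLeast (dlObjective F '' probDists Γ) (dlObjective F p) := by
    refine ⟨⟨p, hp, rfl⟩, ?_⟩
    rintro _ ⟨p', hp', rfl⟩
    exact heq ▸ plObjective_le_dlObjective hp' hw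
  have hgreatest : IsGreatest (plObjective '' plWeights F) (dlObjective F p) := by
    refine ⟨⟨w, hw, heq⟩, ?_⟩
    rintro _ ⟨w', hw', rfl⟩
    exact plObjective_le_dlObjective hp hw'
  have hDL : DL F = dlObjective F p := hleast.isGLB.sInf_eq
  have hPL : PL F = dlObjective F p := hgreatest.isLUB.sSup_eq
  have hle : ENNReal.ofReal (errorConst ε) * DL F ≤ (naQueryComplexity F ε : ℝ≥0∞) :=
    le_naQueryComplexity fun T A hA => hA.errorConst_mul_DL_le hF hε₀ hε
  refine ⟨fun p _ => isGreatest_dlObjective hF p, hDL ▸ hleast, hPL ▸ hgreatest,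
    hDL.trans hPL.symm, hDL ▸ hfin, hle, ?_⟩
  rw [hPL, ← hDL]
  exact hle
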